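/- Let $Q_d=\operatorname{conv}(\{0,1\}^d)\subset\mathbb{R}^d$ be the $d$-dimensional hypercube. Its vertex slice sequence is \[ VSS(Q_d)=\{\,|V(H\cap Q_d)| : H\subset\mathbb{R}^d \text{ an affine hyperplane with } H\cap Q_d\neq\emptyset\,\}, \] where $V(H\cap Q_d)$ is the set of vertices of the polytope $H\cap Q_d$ (hyperplanes that touch $Q_d$ only in a face are included). Write $[n]=\{1,2,\dots,n\}$. Then \begin{align*} VSS(Q_2)&=[2],\\ VSS(Q_3)&=[6],\\ VSS(Q_4)&=[12]\setminus\{3,5\},\\ VSS(Q_5)&=[30]\setminus\{3,6,7,9\},\\ VSS(Q_6)&=[60]\setminus\{3,5,7,9,11,12,59\},\\ VSS(Q_7)&=[140]\setminus\{3,5,6,9,10,11,13,14,15,18\}. \end{align*} -/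

import Mathlib

/-- `H` is an affine hyperplane of `ℝ^d`: the solution set of `⟪u, x⟫ = t` for some normal
vector `u ≠ 0` and some real `t`. -/
def IsHyperplane {d : ℕ} (H : Set (EuclideanSpace ℝ (Fin d))) : Prop :=
  ∃ (u : EuclideanSpace ℝ (Fin d)) (t : ℝ), u ≠ 0 ∧ H = {x | inner ℝ u x = t}

/-- The number of vertices (extreme points) of the slice `H ∩ P`, as an extended natural number,
so that no junk value is used if the set of vertices is infinite. -/
noncomputable def cv {d : ℕ} (P H : Set (EuclideanSpace ℝ (Fin d))) : ℕ∞ :=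
  ((H ∩ P).extremePoints ℝ).encard

/-- The vertex slice sequence of `P`: the set of all numbers of vertices of the slices `H ∩ P`,
where `H` runs over the hyperplanes that meet `P`. -/
def VSS {d : ℕ} (P : Set (EuclideanSpace ℝ (Fin d))) : Set ℕ :=
  {m | ∃ H : Set (EuclideanSpace ℝ (Fin d)), IsHyperplane H ∧ (H ∩ P).Nonempty ∧ cv P H = m}

/-- The hypercube `Q_d`: the convex hull of the `2^d` points with all coordinates `0` or `1`. -/
def hypercube (d : ℕ) : Set (EuclideanSpace ℝ (Fin d)) :=
  convexHull ℝ {x | ∀ i, x i = 0 ∨ x i = 1}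

open Finset

/-! Reflecting coordinates makes all weights nonnegative, and the vertices of the slice are then the
cube vertices on the hyperplane together with the edges crossing it. With cube vertices as subsets
`S` and edges as pairs `(S, i)`, `sliceCount` counts these items, and the problem becomes
combinatorial.

Maxima: for positive weights and a hyperplane through the interior, every maximal chain meets
exactly one item (`sum_factorial_eq`). The least number of chains through an item gives the bounds
2, 6, 12, 30, 60, 140.

Gaps: a zero weight makes the slice a prism, with twice the count of a slice one dimension lower.
Otherwise, up to central symmetry, there are two cases. If some weight reaches `t`, the count is `c
+ (d - a) * n` with tightly constrained parameters (`exists_sliceCount_eq_of_le`). If not, levels 0,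
1 are separated from levels `d - 1`, `d`, and the chain identity forces at least `d.choose 2` items,
beyond every gap except 59. The value 59 is excluded by near-equality in the chain identity
(`sliceCount_ne_fiftynine`).

Attained values: explicit integer weights and thresholds, evaluated by computation; prisms supply
most even values. -/

/-- For nonnegative weights `u` on a finite set `s` this is the number of vertices of the slice of the
cube `[0, 1]^s` by `∑ u i * x i = t`: the vertices of the cube on the hyperplane, and the edges
that cross it. -/
noncomputable def sliceCount {ι : Type*} [DecidableEq ι] (s : Finset ι) (u : ι → ℝ) (t : ℝ) : ℕ :=
  #{S ∈ s.powerset | ∑ i ∈ S, u i = t} +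
    #{p ∈ s.powerset ×ˢ s | ∑ i ∈ p.1, u i < t ∧ t < ∑ i ∈ insert p.2 p.1, u i}

/-- The number of vertices of the cube strictly below the hyperplane. -/
noncomputable def belowCount {ι : Type*} [DecidableEq ι] (s : Finset ι) (u : ι → ℝ) (t : ℝ) : ℕ :=
  #{S ∈ s.powerset | ∑ i ∈ S, u i < t}

/-! ### Recursions and symmetry for the vertex count of a slice -/

section Combinatorics

variable {ι : Type*} [DecidableEq ι] {s A B : Finset ι} {u : ι → ℝ} {t : ℝ}

lemma sliceCount_eq_sum (s : Finset ι) (u : ι → ℝ) (t : ℝ) :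
    sliceCount s u t = ∑ S ∈ s.powerset, ((if ∑ i ∈ S, u i = t then 1 else 0) +
      ∑ i ∈ s, if ∑ i ∈ S, u i < t ∧ t < ∑ i ∈ insert i S, u i then 1 else 0) := by
  rw [sliceCount, card_filter, card_filter, sum_product, sum_add_distrib]

lemma belowCount_eq_sum (s : Finset ι) (u : ι → ℝ) (t : ℝ) :
    belowCount s u t = ∑ S ∈ s.powerset, if ∑ i ∈ S, u i < t then 1 else 0 := by
  rw [belowCount, card_filter]

/-- The two facets orthogonal to direction `a` are sliced at `t` and at `t - u a`; the last term
counts the crossing edges that join these facets. -/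
lemma sliceCount_insert {a : ι} (ha : a ∉ s) (u : ι → ℝ) (t : ℝ) :
    sliceCount (insert a s) u t = sliceCount s u t + sliceCount s u (t - u a) +
      #{S ∈ s.powerset | ∑ i ∈ S, u i < t ∧ t < ∑ i ∈ S, u i + u a} := by
  rw [sliceCount_eq_sum, sliceCount_eq_sum, sliceCount_eq_sum, sum_powerset_insert ha,
    card_filter, ← sum_add_distrib, ← sum_add_distrib, ← sum_add_distrib]
  refine sum_congr rfl fun S hS => ?_
  have hS' : a ∉ S := fun h => ha (mem_powerset.1 hS h)
  rw [sum_insert ha, sum_insert ha, insert_idem, sum_insert hS',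
    if_neg (c := u a + ∑ i ∈ S, u i < t ∧ _) (fun h => lt_asymm h.1 h.2)]
  have h1 : ∀ i ∈ s, (if u a + ∑ i ∈ S, u i < t ∧ t < ∑ i ∈ insert i (insert a S), u i then 1 else 0) =
      (if ∑ i ∈ S, u i < t - u a ∧ t - u a < ∑ i ∈ insert i S, u i then 1 else 0) := by
    intro i hi
    have hia : a ∉ insert i S := by
      rw [mem_insert]; rintro (rfl | h)
      exacts [ha hi, hS' h]
    rw [Finset.insert_comm, sum_insert hia]
    simp only [lt_sub_iff_add_lt', sub_lt_iff_lt_add']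
  rw [sum_congr rfl h1, add_comm (u a)]
  simp only [← eq_sub_iff_add_eq]
  ring

lemma sliceCount_insert_of_eq_zero {a : ι} (ha : a ∉ s) (h : u a = 0) :
    sliceCount (insert a s) u t = 2 * sliceCount s u t := by
  rw [sliceCount_insert ha, h, filter_false_of_mem, card_empty, sub_zero]
  · ring
  · intro S _ h; linarith [h.1, h.2]

lemma sliceCount_eq_zero_of_lt (hu : ∀ i ∈ s, 0 ≤ u i) (h : ∑ i ∈ s, u i < t) :
    sliceCount s u t = 0 := by
  rw [sliceCount_eq_sum]
  refine sum_eq_zero fun S hS => ?_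
  have hS := mem_powerset.1 hS
  have h1 := sum_le_sum_of_subset_of_nonneg hS fun i hi _ => hu i hi
  rw [if_neg (by linarith), zero_add]
  refine sum_eq_zero fun i hi => if_neg fun h' => ?_
  have := sum_le_sum_of_subset_of_nonneg (insert_subset hi hS) fun i hi _ => hu i hi
  linarith [h'.2]

/-- No set containing `b` is below the hyperplane. Hence each `S` below it yields exactly one new
item: `insert b S` if that lies on the hyperplane, otherwise the crossing edge in direction `b`. -/
lemma sliceCount_insert_of_le {b : ι} (hb : b ∉ s) (hu : ∀ i ∈ s, 0 ≤ u i) (hb0 : 0 < u b)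
    (h : t ≤ u b) : sliceCount (insert b s) u t = sliceCount s u t + belowCount s u t := by
  rw [sliceCount_insert hb, add_assoc, sliceCount_eq_sum s u (t - u b), card_filter,
    belowCount_eq_sum, ← sum_add_distrib]
  congr 1
  refine sum_congr rfl fun S hS => ?_
  have h0 := sum_nonneg fun i hi => hu i (mem_powerset.1 hS hi)
  rw [sum_eq_zero (s := s) fun i _ => if_neg fun h' => by linarith [h'.1]]
  split_ifs <;> first | rfl | (exfalso; grind)

lemma belowCount_insert_of_le {b : ι} (hb : b ∉ s) (hu : ∀ i ∈ s, 0 ≤ u i)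
    (h : t ≤ u b) : belowCount (insert b s) u t = belowCount s u t := by
  rw [belowCount_eq_sum, belowCount_eq_sum, sum_powerset_insert hb]
  refine add_eq_left.2 (sum_eq_zero fun S hS => if_neg ?_)
  have h0 := sum_nonneg fun i hi => hu i (mem_powerset.1 hS hi)
  rw [sum_insert fun h => hb (mem_powerset.1 hS h)]
  linarith

lemma sliceCount_union (hAB : Disjoint A B) (hu : ∀ i ∈ A ∪ B, 0 < u i)
    (hB : ∀ i ∈ B, t ≤ u i) :
    sliceCount (A ∪ B) u t = sliceCount A u t + #B * belowCount A u t := by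
  -- Each insertion adds one item per set below in the current cube, so the induction must also
  -- carry that this number stays `belowCount A u t`.
  suffices sliceCount (A ∪ B) u t = sliceCount A u t + #B * belowCount A u t ∧
    belowCount (A ∪ B) u t = belowCount A u t from this.1
  induction B using Finset.induction_on with
  | empty => simp
  | insert b B hb ih =>
    rw [union_insert] at hu ⊢
    rw [disjoint_insert_right] at hAB
    have hb' : b ∉ A ∪ B := by simp [hAB.1, hb]
    have hu' : ∀ i ∈ A ∪ B, 0 ≤ u i := fun i hi => (hu i (mem_insert_of_mem hi)).le
    obtain ⟨h1, h2⟩ := ih hAB.2 (fun i hi => hu i (mem_insert_of_mem hi))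
      (fun i hi => hB i (mem_insert_of_mem hi))
    have hbt := hB b (mem_insert_self _ _)
    rw [sliceCount_insert_of_le hb' hu' (hu b (mem_insert_self _ _)) hbt,
      belowCount_insert_of_le hb' hu' hbt, h1, h2, card_insert_of_notMem hb]
    exact ⟨by ring, rfl⟩

lemma belowCount_eq_two_pow (hu : ∀ i ∈ s, 0 ≤ u i) (h : ∑ i ∈ s, u i < t) :
    belowCount s u t = 2 ^ #s := by
  rw [belowCount, filter_true_of_mem, card_powerset]
  intro S hS
  exact (sum_le_sum_of_subset_of_nonneg (mem_powerset.1 hS) fun i hi _ => hu i hi).trans_lt h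

/-- Below the hyperplane there are at least the empty set and the singletons. -/
lemma card_add_one_le_belowCount (ht : 0 < t) (h : ∀ i ∈ s, u i < t) :
    #s + 1 ≤ belowCount s u t := by
  have : (insert ∅ (s.image singleton) : Finset (Finset ι)) ⊆
      {S ∈ s.powerset | ∑ i ∈ S, u i < t} := by
    intro S hS
    simp only [mem_insert, mem_image] at hS
    rcases hS with rfl | ⟨i, hi, rfl⟩
    · simpa using ht
    · simpa [hi] using h i hi
  refine le_trans (le_of_eq ?_) (card_le_card this)
  rw [card_insert_of_notMem (by simp), card_image_of_injective _ singleton_injective]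

/-- Each pair of elements gives a vertex below or on the hyperplane, or the top of a crossing
edge. -/
lemma card_choose_le (ht : 0 < t) (h : ∀ i ∈ s, u i < t) :
    1 + #s + (#s).choose 2 ≤ sliceCount s u t + belowCount s u t := by
  let X : Finset (Finset ι) := insert ∅ (s.powersetCard 1 ∪ s.powersetCard 2)
  have hX : #X = 1 + #s + (#s).choose 2 := by
    rw [card_insert_of_notMem, card_union_of_disjoint, card_powersetCard, card_powersetCard,
      Nat.choose_one_right]
    · ring
    · exact (pairwise_disjoint_powersetCard s) (by norm_num : (1 : ℕ) ≠ 2)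
    · simp [mem_powersetCard]
  let Y := ({S ∈ s.powerset | ∑ i ∈ S, u i < t} ∪ {S ∈ s.powerset | ∑ i ∈ S, u i = t}) ∪
    ({p ∈ s.powerset ×ˢ s | ∑ i ∈ p.1, u i < t ∧ t < ∑ i ∈ insert p.2 p.1, u i} :
      Finset (Finset ι × ι)).image fun p => insert p.2 p.1
  have hXY : X ⊆ Y := by
    intro S hS
    have hSs : S ⊆ s ∧ (t < ∑ i ∈ S, u i → #S = 2) := by
      simp only [X, mem_insert, mem_union, mem_powersetCard] at hS
      rcases hS with rfl | hS | hS
      · exact ⟨by simp, fun h => by simp at h; linarith⟩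
      · refine ⟨hS.1, fun h' => ?_⟩
        obtain ⟨i, rfl⟩ := card_eq_one.1 hS.2
        rw [sum_singleton] at h'
        linarith [h i (by simpa using hS.1)]
      · exact ⟨hS.1, fun _ => hS.2⟩
    simp only [Y, mem_union, mem_filter, mem_powerset, mem_image]
    rcases lt_trichotomy (∑ i ∈ S, u i) t with h1 | h1 | h1
    · exact .inl (.inl ⟨hSs.1, h1⟩)
    · exact .inl (.inr ⟨hSs.1, h1⟩)
    · obtain ⟨i, j, hij, rfl⟩ := card_eq_two.1 (hSs.2 h1)
      have hi : i ∈ s := hSs.1 (by simp)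
      have hj : j ∈ s := hSs.1 (by simp)
      exact .inr ⟨({j}, i), by simpa [hi, hj, h j hj] using h1, rfl⟩
  have h1 := card_le_card hXY
  have h2 : #Y ≤ _ := (card_union_le _ _).trans
    (add_le_add (card_union_le _ _) (card_image_le (f := fun p : Finset ι × ι => insert p.2 p.1)))
  rw [sliceCount, belowCount]
  omega

/-- Central symmetry of the cube: `S` goes to `s \ S`, and an edge is reversed, so its new lower end
is the complement of its old upper end. -/
lemma sliceCount_compl (s : Finset ι) (u : ι → ℝ) (t : ℝ) :
    sliceCount s u (∑ i ∈ s, u i - t) = sliceCount s u t := by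
  have hsd : ∀ S ⊆ s, ∑ i ∈ s \ S, u i = ∑ i ∈ s, u i - ∑ i ∈ S, u i := fun S hS => by
    rw [← sum_sdiff hS]; ring
  unfold sliceCount
  congr 1
  · refine card_bij' (fun S _ => s \ S) (fun S _ => s \ S) ?_ ?_ ?_ ?_
    · intro S hS
      simp only [mem_filter, mem_powerset] at hS ⊢
      exact ⟨sdiff_subset, by rw [hsd S hS.1, hS.2]; ring⟩
    · intro S hS
      simp only [mem_filter, mem_powerset] at hS ⊢
      exact ⟨sdiff_subset, by rw [hsd S hS.1, hS.2]⟩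
    · intro S hS
      simp only [mem_filter, mem_powerset] at hS
      exact Finset.sdiff_sdiff_eq_self hS.1
    · intro S hS
      simp only [mem_filter, mem_powerset] at hS
      exact Finset.sdiff_sdiff_eq_self hS.1
  · have key : ∀ (r r' : ℝ), r + r' = ∑ i ∈ s, u i → ∀ p : Finset ι × ι,
        p ∈ ({p ∈ s.powerset ×ˢ s | ∑ i ∈ p.1, u i < r ∧ r < ∑ i ∈ insert p.2 p.1, u i} :
          Finset (Finset ι × ι)) →
        (s \ insert p.2 p.1, p.2) ∈
          ({p ∈ s.powerset ×ˢ s | ∑ i ∈ p.1, u i < r' ∧ r' < ∑ i ∈ insert p.2 p.1, u i} :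
          Finset (Finset ι × ι)) ∧ s \ insert p.2 (s \ insert p.2 p.1) = p.1 := by
      rintro r r' hr ⟨S, i⟩ hp
      simp only [mem_filter, mem_product, mem_powerset] at hp ⊢
      obtain ⟨⟨hS, hi⟩, h1, h2⟩ := hp
      have hiS : i ∉ S := fun h => by
        rw [insert_eq_of_mem h] at h2; linarith
      have h3 : insert i (s \ insert i S) = s \ S := by grind
      rw [h3, hsd S hS, hsd _ (insert_subset hi hS)]
      exact ⟨⟨⟨sdiff_subset, hi⟩, by linarith, by linarith⟩, Finset.sdiff_sdiff_eq_self hS⟩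
    refine card_bij' (fun p _ => (s \ insert p.2 p.1, p.2)) (fun p _ => (s \ insert p.2 p.1, p.2))
      ?_ ?_ ?_ ?_
    · exact fun p hp => (key _ _ (by ring) p hp).1
    · exact fun p hp => (key _ _ (by ring) p hp).1
    · exact fun p hp => Prod.ext (key _ t (by ring) p hp).2 rfl
    · exact fun p hp => Prod.ext (key _ (∑ i ∈ s, u i - t) (by ring) p hp).2 rfl

end Combinatorics

/-! ### The chain identity and the bounds it gives -/

section Flow

open scoped Nat

variable {ι : Type*} [DecidableEq ι] {s : Finset ι} {u : ι → ℝ} {t : ℝ}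

/-- The LYM identity for the vertices and edges met by a hyperplane: every maximal chain of the
cube meets exactly one of them. -/
lemma sum_factorial_eq (hu : ∀ i ∈ s, 0 < u i) (ht : 0 < t) (hts : t ≤ ∑ i ∈ s, u i) :
    ∑ S ∈ s.powerset with ∑ i ∈ S, u i = t, (#S)! * (#s - #S)! +
      ∑ p ∈ s.powerset ×ˢ s with ∑ i ∈ p.1, u i < t ∧ t < ∑ i ∈ insert p.2 p.1, u i,
        (#p.1)! * (#s - 1 - #p.1)! = (#s)! := by
  -- An edge leaving level `k` carries the number of maximal chains through it, `k! * (#s - 1 -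
  -- k)!`. The `#s - k` edges out of `S` together carry the `k! * (#s - k)!` chains through `S`.
  have hout : ∑ p ∈ s.powerset ×ˢ s with ∑ i ∈ p.1, u i < t ∧ p.2 ∉ p.1,
      (#p.1)! * (#s - 1 - #p.1)! =
      ∑ S ∈ s.powerset with ∑ i ∈ S, u i < t, (#S)! * (#s - #S)! := by
    rw [sum_filter, sum_product, sum_filter]
    refine sum_congr rfl fun S hS => ?_
    have hSs := mem_powerset.1 hS
    split_ifs with h
    · have hlt : #S < #s := card_lt_card (hSs.ssubset_of_ne (by rintro rfl; linarith))
      simp only [h, true_and]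
      rw [← sum_filter, sum_const, filter_notMem_eq_sdiff, card_sdiff_of_subset hSs, smul_eq_mul]
      obtain ⟨k, hk⟩ := Nat.exists_eq_add_of_lt hlt
      rw [hk, show #S + k + 1 - #S = k + 1 by omega, show #S + k + 1 - 1 - #S = k by omega,
        Nat.factorial_succ]
      ring
    · exact sum_eq_zero fun i _ => if_neg fun h' => h h'.1
  -- Edges into a nonempty set also carry all chains through it. Only the source `∅` has no incoming
  -- edge, which accounts for the extra `(#s)!`.
  have hin : ∑ p ∈ s.powerset ×ˢ s with ∑ i ∈ p.1, u i ≤ t ∧ p.2 ∈ p.1,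
      (#p.1 - 1)! * (#s - #p.1)! + (#s)! =
      ∑ S ∈ s.powerset with ∑ i ∈ S, u i ≤ t, (#S)! * (#s - #S)! := by
    rw [sum_filter, sum_product, sum_filter, ← add_sum_erase _ _ (empty_mem_powerset s),
      ← add_sum_erase _ _ (empty_mem_powerset s)]
    simp only [sum_empty, ht.le, notMem_empty, and_false, if_false, sum_const_zero, if_true,
      card_empty, Nat.sub_zero, Nat.factorial_zero, one_mul, zero_add]
    rw [add_comm]
    congr 1
    refine sum_congr rfl fun S hS => ?_
    obtain ⟨hne, hS⟩ := mem_erase.1 hS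
    have hSs := mem_powerset.1 hS
    split_ifs with h
    · simp only [h, true_and]
      rw [← sum_filter, sum_const, filter_mem_eq_inter, inter_eq_right.2 hSs, smul_eq_mul,
        ← mul_assoc, Nat.mul_factorial_pred (card_ne_zero.2 (nonempty_iff_ne_empty.2 hne))]
    · exact sum_eq_zero fun i _ => if_neg fun h' => h h'.1
  -- The non-crossing edges out of sets below the hyperplane are exactly the edges into sets below
  -- or on it; positivity of the weights puts the lower end strictly below.
  have hbij : ∑ p ∈ s.powerset ×ˢ s with
      (∑ i ∈ p.1, u i < t ∧ p.2 ∉ p.1) ∧ ¬ t < ∑ i ∈ insert p.2 p.1, u i,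
        (#p.1)! * (#s - 1 - #p.1)! =
      ∑ p ∈ s.powerset ×ˢ s with ∑ i ∈ p.1, u i ≤ t ∧ p.2 ∈ p.1,
        (#p.1 - 1)! * (#s - #p.1)! := by
    refine sum_bij' (fun p _ => (insert p.2 p.1, p.2)) (fun p _ => (p.1.erase p.2, p.2))
      ?_ ?_ ?_ ?_ ?_
    · rintro ⟨S, i⟩ h
      simp only [mem_filter, mem_product, mem_powerset, not_lt] at h ⊢
      exact ⟨⟨insert_subset h.1.2 h.1.1, h.1.2⟩, h.2.2, mem_insert_self _ _⟩
    · rintro ⟨S, i⟩ h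
      simp only [mem_filter, mem_product, mem_powerset, not_lt] at h ⊢
      obtain ⟨⟨h1, h2⟩, h3, h4⟩ := h
      rw [insert_erase h4]
      refine ⟨⟨(erase_subset _ _).trans h1, h2⟩, ⟨?_, notMem_erase _ _⟩, h3⟩
      have := add_sum_erase _ u h4
      linarith [hu i h2]
    · rintro ⟨S, i⟩ h
      simp only [mem_filter] at h
      exact Prod.ext (erase_insert h.2.1.2) rfl
    · rintro ⟨S, i⟩ h
      simp only [mem_filter] at h
      exact Prod.ext (insert_erase h.2.2) rfl
    · rintro ⟨S, i⟩ h
      simp only [mem_filter] at h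
      dsimp only
      rw [card_insert_of_notMem h.2.1.2, Nat.add_sub_cancel, Nat.sub_sub, add_comm 1]
  have hcross : ∑ p ∈ s.powerset ×ˢ s with
      (∑ i ∈ p.1, u i < t ∧ p.2 ∉ p.1) ∧ t < ∑ i ∈ insert p.2 p.1, u i,
        (#p.1)! * (#s - 1 - #p.1)! =
      ∑ p ∈ s.powerset ×ˢ s with ∑ i ∈ p.1, u i < t ∧ t < ∑ i ∈ insert p.2 p.1, u i,
        (#p.1)! * (#s - 1 - #p.1)! := by
    congr 1
    refine filter_congr fun p _ => ⟨fun h => ⟨h.1.1, h.2⟩, fun h => ⟨⟨h.1, fun h' => ?_⟩, h.2⟩⟩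
    rw [insert_eq_of_mem h'] at h
    linarith [h.1, h.2]
  have hsplit := sum_filter_add_sum_filter_not
    {p ∈ s.powerset ×ˢ s | ∑ i ∈ p.1, u i < t ∧ p.2 ∉ p.1}
    (fun p => t < ∑ i ∈ insert p.2 p.1, u i) (fun p => (#p.1)! * (#s - 1 - #p.1)!)
  rw [filter_filter, filter_filter, hcross, hbij, hout] at hsplit
  have hle : ∑ S ∈ s.powerset with ∑ i ∈ S, u i ≤ t, (#S)! * (#s - #S)! =
      ∑ S ∈ s.powerset with ∑ i ∈ S, u i < t, (#S)! * (#s - #S)! +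
      ∑ S ∈ s.powerset with ∑ i ∈ S, u i = t, (#S)! * (#s - #S)! := by
    simp only [sum_filter, ← sum_add_distrib]
    refine sum_congr rfl fun S _ => ?_
    rcases lt_trichotomy (∑ i ∈ S, u i) t with h | h | h
    · simp [h, h.le, h.ne]
    · simp [h]
    · simp [h.not_ge, h.not_gt, h.ne']
  omega

lemma sliceCount_mul_le {m : ℕ} (hu : ∀ i ∈ s, 0 < u i) (ht : 0 < t) (hts : t ≤ ∑ i ∈ s, u i)
    (hv : ∀ k ≤ #s, m ≤ k ! * (#s - k)!) (he : ∀ k < #s, m ≤ k ! * (#s - 1 - k)!) :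
    sliceCount s u t * m ≤ (#s)! := by
  rw [← sum_factorial_eq hu ht hts, sliceCount, add_mul, ← smul_eq_mul, ← smul_eq_mul]
  refine add_le_add (card_nsmul_le_sum _ _ _ fun S hS => ?_) (card_nsmul_le_sum _ _ _ fun p hp => ?_)
  · exact hv _ (card_le_card (mem_powerset.1 (mem_filter.1 hS).1))
  · simp only [mem_filter, mem_product, mem_powerset] at hp
    refine he _ (card_lt_card (hp.1.1.ssubset_of_ne ?_))
    rintro h
    rw [insert_eq_of_mem (h ▸ hp.1.2)] at hp
    linarith [hp.2.1, hp.2.2]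

/-- If the hyperplane separates the levels `0, 1` from the levels `#s - 1, #s` then the items in
the LYM identity lie in the middle levels. -/
lemma le_sliceCount_mul {m : ℕ} (hu : ∀ i ∈ s, 0 < u i) (ht : 0 < t) (hts : t < ∑ i ∈ s, u i)
    (h1 : ∀ i ∈ s, u i < t) (h2 : ∀ i ∈ s, u i < ∑ i ∈ s, u i - t)
    (hv : ∀ k, 2 ≤ k → k + 2 ≤ #s → k ! * (#s - k)! ≤ m)
    (he : ∀ k, 1 ≤ k → k + 2 ≤ #s → k ! * (#s - 1 - k)! ≤ m) :
    (#s)! ≤ sliceCount s u t * m := by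
  have low : ∀ S ⊆ s, t ≤ ∑ i ∈ S, u i → 2 ≤ #S := by
    intro S hS h
    by_contra! hlt
    rcases (Nat.lt_succ_iff.1 hlt).lt_or_eq with h0 | h0
    · rw [card_eq_zero.1 (Nat.lt_one_iff.1 h0), sum_empty] at h
      linarith
    · obtain ⟨i, rfl⟩ := card_eq_one.1 h0
      rw [sum_singleton] at h
      linarith [h1 i (by simpa using hS)]
  have high : ∀ S ⊆ s, ∑ i ∈ S, u i ≤ t → #S + 2 ≤ #s := by
    intro S hS h
    by_contra! hlt
    have hc := card_sdiff_add_card_eq_card hS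
    have hs := sum_sdiff (f := u) hS
    rcases (show #(s \ S) ≤ 1 by omega).lt_or_eq with h0 | h0
    · rw [card_eq_zero.1 (Nat.lt_one_iff.1 h0), sum_empty] at hs
      linarith
    · obtain ⟨i, hi⟩ := card_eq_one.1 h0
      rw [hi, sum_singleton] at hs
      have : i ∈ s \ S := by simp [hi]
      linarith [h2 i (mem_sdiff.1 this).1]
  rw [← sum_factorial_eq hu ht hts.le, sliceCount, add_mul, ← smul_eq_mul, ← smul_eq_mul]
  refine add_le_add (sum_le_card_nsmul _ _ _ fun S hS => ?_) (sum_le_card_nsmul _ _ _ fun p hp => ?_)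
  · simp only [mem_filter, mem_powerset] at hS
    exact hv _ (low S hS.1 hS.2.ge) (high S hS.1 hS.2.le)
  · simp only [mem_filter, mem_product, mem_powerset] at hp
    have := low _ (insert_subset hp.1.2 hp.1.1) hp.2.2.le
    have := card_insert_le p.2 p.1
    exact he _ (by omega) (high _ hp.1.1 hp.2.1.le)

end Flow

/-! ### Bounds and excluded values in each dimension -/

section Values

open scoped Nat

variable {ι : Type*} [DecidableEq ι] {s : Finset ι} {u : ι → ℝ} {t : ℝ}

lemma sliceCount_le_one_of_nonpos (hu : ∀ i ∈ s, 0 < u i) (ht : t ≤ 0) : sliceCount s u t ≤ 1 := by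
  have h0 : ∀ S ⊆ s, 0 ≤ ∑ i ∈ S, u i := fun S hS => sum_nonneg fun i hi => (hu i (hS hi)).le
  rw [sliceCount, filter_false_of_mem (s := s.powerset ×ˢ s), card_empty, add_zero, card_le_one]
  · have key : ∀ S ∈ ({S ∈ s.powerset | ∑ i ∈ S, u i = t} : Finset (Finset ι)), S = ∅ := by
      intro S hS
      simp only [mem_filter, mem_powerset] at hS
      by_contra hne
      linarith [sum_pos (fun i hi => hu i (hS.1 hi)) (nonempty_iff_ne_empty.2 hne)]
    exact fun S hS T hT => (key S hS).trans (key T hT).symm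
  · intro p hp h
    linarith [h0 p.1 (mem_powerset.1 (mem_product.1 hp).1), h.1]

lemma sliceCount_le_one_or (hu : ∀ i ∈ s, 0 < u i) :
    sliceCount s u t ≤ 1 ∨ 0 < t ∧ t < ∑ i ∈ s, u i := by
  rcases le_or_gt t 0 with h | h
  · exact .inl (sliceCount_le_one_of_nonpos hu h)
  rcases le_or_gt (∑ i ∈ s, u i) t with h' | h'
  · rw [← sliceCount_compl]
    exact .inl (sliceCount_le_one_of_nonpos hu (by linarith))
  · exact .inr ⟨h, h'⟩

/-- Here `a` is the number of weights below `t`, while `c` and `n` are `sliceCount` and `belowCount`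
of the face they span; each of the other `#s - a` weights adds `n` items. For `a ≤ 1` that face lies
entirely below the hyperplane, and for `a = 2` it is a square, with at most two items. -/
lemma exists_sliceCount_eq_of_le (hu : ∀ i ∈ s, 0 < u i) (ht : 0 < t) (h : ∃ i ∈ s, t ≤ u i) :
    ∃ a c n, a < #s ∧ sliceCount s u t = c + (#s - a) * n ∧ 1 + a + a.choose 2 ≤ c + n ∧ a + 1 ≤ n ∧
      (a ≤ 1 → c = 0 ∧ n = 2 ^ a) ∧ (a = 2 → c ≤ 2) := by
  set A := {i ∈ s | u i < t} with hA
  set B := {i ∈ s | ¬ u i < t} with hB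
  have hAB : A ∪ B = s := filter_union_filter_not_eq _ s
  have hd : Disjoint A B := disjoint_filter_filter_not _ _ _
  have hc : #A + #B = #s := by rw [← card_union_of_disjoint hd, hAB]
  have hB0 : 0 < #B := by
    obtain ⟨i, hi, hit⟩ := h
    exact card_pos.2 ⟨i, mem_filter.2 ⟨hi, hit.not_gt⟩⟩
  have hAt : ∀ i ∈ A, u i < t := fun i hi => (mem_filter.1 hi).2
  have hA0 : ∀ i ∈ A, 0 < u i := fun i hi => hu i (mem_filter.1 hi).1
  have hA0' : ∀ i ∈ A, 0 ≤ u i := fun i hi => (hA0 i hi).le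
  refine ⟨#A, sliceCount A u t, belowCount A u t, by omega, ?_, card_choose_le ht hAt,
    card_add_one_le_belowCount ht hAt, fun h1 => ?_, fun h2 => ?_⟩
  · rw [← hc, Nat.add_sub_cancel_left, ← sliceCount_union hd (by rwa [hAB]), hAB]
    exact fun i hi => not_lt.1 (mem_filter.1 hi).2
  · have hsum : ∑ i ∈ A, u i < t := by
      rcases h1.lt_or_eq with h1 | h1
      · rw [card_eq_zero.1 (Nat.lt_one_iff.1 h1), sum_empty]
        exact ht
      · obtain ⟨i, hi⟩ := card_eq_one.1 h1
        rw [hi, sum_singleton]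
        exact hAt i (by simp [hi])
    exact ⟨sliceCount_eq_zero_of_lt hA0' hsum, belowCount_eq_two_pow hA0' hsum⟩
  · rcases lt_or_ge (∑ i ∈ A, u i) t with hlt | hge
    · rw [sliceCount_eq_zero_of_lt hA0' hlt]
      omega
    · have := sliceCount_mul_le (m := 1) hA0 ht hge
        (fun k _ => Nat.mul_pos (Nat.factorial_pos _) (Nat.factorial_pos _))
        (fun k _ => Nat.mul_pos (Nat.factorial_pos _) (Nat.factorial_pos _))
      rwa [h2, mul_one] at this

/-- If no weight reaches `t` or the complementary threshold, the chain identity bounds the count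
from below. The redundant bounds `k < d` make the conditions on `m` decidable for numerical `d`. -/
lemma sliceCount_structure {d : ℕ} (hs : #s = d) (hu : ∀ i ∈ s, 0 < u i) (ht : 0 < t)
    (hts : t < ∑ i ∈ s, u i) :
    (∃ a c n, a < d ∧ sliceCount s u t = c + (d - a) * n ∧ 1 + a + a.choose 2 ≤ c + n ∧
      a + 1 ≤ n ∧ (a ≤ 1 → c = 0 ∧ n = 2 ^ a) ∧ (a = 2 → c ≤ 2)) ∨
    ∀ m, (∀ k < d, 2 ≤ k → k + 2 ≤ d → k ! * (d - k)! ≤ m) →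
      (∀ k < d, 1 ≤ k → k + 2 ≤ d → k ! * (d - 1 - k)! ≤ m) → d ! ≤ sliceCount s u t * m := by
  subst hs
  by_cases h1 : ∃ i ∈ s, t ≤ u i
  · exact .inl (exists_sliceCount_eq_of_le hu ht h1)
  by_cases h2 : ∃ i ∈ s, ∑ i ∈ s, u i - t ≤ u i
  · rw [← sliceCount_compl]
    exact .inl (exists_sliceCount_eq_of_le hu (by linarith) h2)
  · push Not at h1 h2
    exact .inr fun m hv he => le_sliceCount_mul hu ht hts h1 h2
      (fun k h hk => hv k (by omega) h hk) (fun k h hk => he k (by omega) h hk)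

/-- Edges leaving levels 0 to 5 lie on 120, 24, 12, 12, 24, 120 chains, and vertices on at least 36.
Since 720 = 59 * 12 + 12, there would be no vertex on the hyperplane, no crossing edge at level 0 or
5, and exactly one at level 1 or 4. But such an edge forces a second one at the same level. -/
lemma sliceCount_ne_fiftynine (hs : #s = 6) (hu : ∀ i ∈ s, 0 < u i) (ht : 0 < t)
    (hts : t < ∑ i ∈ s, u i) : sliceCount s u t ≠ 59 := by
  intro h59
  have hsum := sum_factorial_eq hu ht hts.le
  rw [sliceCount] at h59
  set Z := {S ∈ s.powerset | ∑ i ∈ S, u i = t} with hZ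
  set E := {p ∈ s.powerset ×ˢ s | ∑ i ∈ p.1, u i < t ∧ t < ∑ i ∈ insert p.2 p.1, u i} with hE
  rw [hs] at hsum
  have memE : ∀ S i, (S, i) ∈ E ↔
      (S ⊆ s ∧ i ∈ s) ∧ ∑ i ∈ S, u i < t ∧ t < ∑ i ∈ insert i S, u i := by
    simp [hE]
  have hiS : ∀ S i, (S, i) ∈ E → i ∉ S := by
    intro S i hp hi
    rw [memE, insert_eq_of_mem hi] at hp
    linarith [hp.2.1, hp.2.2]
  have hlt : ∀ p ∈ E, #p.1 < 6 := by
    rintro ⟨S, i⟩ hp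
    have h1 := hiS S i hp
    rw [memE] at hp
    have := card_le_card (insert_subset hp.1.2 hp.1.1)
    rw [card_insert_of_notMem h1] at this
    dsimp only
    omega
  have hwE : ∀ p ∈ E, 12 ≤ (#p.1)! * (6 - 1 - #p.1)! := by
    intro p hp
    have := hlt p hp
    generalize #p.1 = k at *
    interval_cases k <;> decide
  have hwZ : ∀ S ∈ Z, 36 ≤ (#S)! * (6 - #S)! := by
    intro S hS
    have := card_le_card (mem_powerset.1 (mem_filter.1 hS).1)
    rw [hs] at this
    generalize #S = k at *
    interval_cases k <;> decide
  have h6 : 6 ! = 720 := rfl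
  have hZ0 : #Z = 0 := by
    have h1 := card_nsmul_le_sum _ _ _ hwZ
    have h2 := card_nsmul_le_sum _ _ _ hwE
    simp only [smul_eq_mul] at h1 h2
    omega
  have hZ' : ∀ S ⊆ s, ∑ i ∈ S, u i ≠ t := by
    intro S hS h
    have : S ∈ Z := by simp [hZ, hS, h]
    rw [card_eq_zero.1 hZ0] at this
    simp at this
  rw [card_eq_zero.1 hZ0, sum_empty, zero_add] at hsum
  have hexc : ∑ p ∈ E, ((#p.1)! * (6 - 1 - #p.1)! - 12) = 12 := by
    have h1 : ∑ p ∈ E, (((#p.1)! * (6 - 1 - #p.1)! - 12) + 12) = 720 := by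
      rw [← h6, ← hsum]
      exact sum_congr rfl fun p hp => Nat.sub_add_cancel (hwE p hp)
    rw [sum_add_distrib, sum_const, smul_eq_mul] at h1
    omega
  have hmid : ∀ p ∈ E, #p.1 ≠ 0 ∧ #p.1 ≠ 5 := by
    intro p hp
    have h1 := single_le_sum (f := fun p : Finset ι × ι => (#p.1)! * (6 - 1 - #p.1)! - 12)
      (fun _ _ => Nat.zero_le _) hp
    rw [hexc] at h1
    constructor <;> intro h <;> simp only [h] at h1 <;> revert h1 <;> decide
  have huniq : ∀ p ∈ E, ∀ q ∈ E, #p.1 = 1 ∨ #p.1 = 4 → #q.1 = #p.1 → p = q := by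
    intro p hp q hq h1 h2
    by_contra hne
    have h3 := sum_le_sum_of_subset (f := fun p : Finset ι × ι => (#p.1)! * (6 - 1 - #p.1)! - 12)
      (show {p, q} ⊆ E by simp [insert_subset_iff, hp, hq])
    rw [hexc, sum_pair hne] at h3
    rcases h1 with h1 | h1 <;> simp only [h1, h2] at h3 <;> revert h3 <;> decide
  obtain ⟨⟨S, i⟩, hp, hS⟩ : ∃ p ∈ E, #p.1 = 1 ∨ #p.1 = 4 := by
    by_contra! hno
    rw [sum_eq_zero] at hexc
    · omega
    · intro p hp
      have h1 := hlt p hp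
      have h2 := hno p hp
      have h3 := hmid p hp
      generalize #p.1 = k at *
      interval_cases k <;> first | rfl | omega
  have hi := hiS S i hp
  have hp' := (memE _ _).1 hp
  dsimp only at hS
  rcases hS with hS | hS
  · obtain ⟨j, rfl⟩ := card_eq_one.1 hS
    have hj : j ∈ s := by simpa using hp'.1.1
    -- Otherwise the edge from `∅` to `{i}` would cross. With `{i}` below, both edges into `{j, i}`
    -- cross.
    have hneg : u i < t := by
      by_contra! h
      have h1 := hZ' {i} (by simpa using hp'.1.2)
      rw [sum_singleton] at h1
      have := (hmid (∅, i) ((memE _ _).2 ⟨⟨empty_subset _, hp'.1.2⟩, by simpa using ht,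
        by simpa using lt_of_le_of_ne h h1.symm⟩)).1
      simp at this
    have hq : ({i}, j) ∈ E := by
      refine (memE _ _).2 ⟨⟨by simpa using hp'.1.2, hj⟩, by simpa using hneg, ?_⟩
      rw [pair_comm]
      exact hp'.2.2
    have := huniq _ hp _ hq (.inl hS) rfl
    simp only [Prod.mk.injEq, singleton_inj] at this
    simp [this.2] at hi
  · have hsub := insert_subset hp'.1.2 hp'.1.1
    have hcard := card_insert_of_notMem hi
    obtain ⟨k, hk⟩ : (s \ insert i S).Nonempty := by
      rw [← card_pos, card_sdiff_of_subset hsub]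
      omega
    rw [mem_sdiff, mem_insert, not_or] at hk
    obtain ⟨hks, hki, hkS⟩ := hk
    have hsubk := insert_subset hks hp'.1.1
    have hall : insert i (insert k S) = s := by
      refine eq_of_subset_of_card_le (insert_subset hp'.1.2 hsubk) ?_
      rw [card_insert_of_notMem (by simp [hi, Ne.symm hki]), card_insert_of_notMem hkS]
      omega
    -- Dually, otherwise the edge from `insert k S` to `s` would cross at level 5. So both edges out
    -- of `S` cross.
    have hpos : t < ∑ i ∈ insert k S, u i := by
      by_contra! h
      have := (hmid (insert k S, i) ((memE _ _).2 ⟨⟨hsubk, hp'.1.2⟩,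
        lt_of_le_of_ne h (hZ' _ hsubk), by rwa [hall]⟩)).2
      simp only [card_insert_of_notMem hkS] at this
      omega
    have hq : (S, k) ∈ E := (memE _ _).2 ⟨⟨hp'.1.1, hks⟩, hp'.2.1, hpos⟩
    have := huniq _ hp _ hq (.inr hS) rfl
    simp only [Prod.mk.injEq] at this
    exact hki this.2.symm

/-- Either all weights are positive, or the slice is a prism over a slice of a facet. -/
lemma pos_or_exists_sliceCount_eq (hu : ∀ i ∈ s, 0 ≤ u i) (hne : ∃ i ∈ s, u i ≠ 0) (t : ℝ) :
    (∀ i ∈ s, 0 < u i) ∨ ∃ s' : Finset ι, #s = #s' + 1 ∧ (∀ i ∈ s', 0 ≤ u i) ∧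
      (∃ i ∈ s', u i ≠ 0) ∧ sliceCount s u t = 2 * sliceCount s' u t := by
  by_cases h : ∃ a ∈ s, u a = 0
  · obtain ⟨a, ha, ha0⟩ := h
    refine .inr ⟨s.erase a, (card_erase_add_one ha).symm, fun i hi => hu i (mem_of_mem_erase hi),
      ?_, ?_⟩
    · obtain ⟨i, hi, hi0⟩ := hne
      exact ⟨i, mem_erase.2 ⟨by rintro rfl; exact hi0 ha0, hi⟩, hi0⟩
    · rw [← sliceCount_insert_of_eq_zero (notMem_erase a s) ha0, insert_erase ha]
  · push Not at h
    exact .inl fun i hi => (hu i hi).lt_of_ne (h i hi).symm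

lemma sliceCount_mul_le_of_card {d m : ℕ} (hs : #s = d) (hu : ∀ i ∈ s, 0 < u i) (ht : 0 < t)
    (hts : t < ∑ i ∈ s, u i) (hv : ∀ k ≤ d, m ≤ k ! * (d - k)!)
    (he : ∀ k < d, m ≤ k ! * (d - 1 - k)!) : sliceCount s u t * m ≤ d ! := by
  subst hs
  exact sliceCount_mul_le hu ht hts.le hv he

lemma sliceCount_values_one (hs : #s = 1) (hu : ∀ i ∈ s, 0 ≤ u i) (hne : ∃ i ∈ s, u i ≠ 0) :
    sliceCount s u t ≤ 1 := by
  rcases pos_or_exists_sliceCount_eq hu hne t with hu | ⟨s', h', -, ⟨i, hi, -⟩, -⟩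
  · rcases sliceCount_le_one_or (t := t) hu with h | ⟨ht, hts⟩
    · exact h
    · simpa using sliceCount_mul_le_of_card (m := 1) hs hu ht hts (by decide) (by decide)
  · rw [card_eq_zero.1 (by omega : #s' = 0)] at hi
    simp at hi

lemma sliceCount_values_two (hs : #s = 2) (hu : ∀ i ∈ s, 0 ≤ u i) (hne : ∃ i ∈ s, u i ≠ 0) :
    sliceCount s u t ≤ 2 := by
  rcases pos_or_exists_sliceCount_eq hu hne t with hu | ⟨s', h', hu', hne', hc⟩
  · rcases sliceCount_le_one_or (t := t) hu with h | ⟨ht, hts⟩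
    · omega
    · simpa using sliceCount_mul_le_of_card (m := 1) hs hu ht hts (by decide) (by decide)
  · have := sliceCount_values_one (t := t) (by omega : #s' = 1) hu' hne'
    omega

lemma sliceCount_values_three (hs : #s = 3) (hu : ∀ i ∈ s, 0 ≤ u i) (hne : ∃ i ∈ s, u i ≠ 0) :
    sliceCount s u t ≤ 6 := by
  rcases pos_or_exists_sliceCount_eq hu hne t with hu | ⟨s', h', hu', hne', hc⟩
  · rcases sliceCount_le_one_or (t := t) hu with h | ⟨ht, hts⟩
    · omega
    · simpa [Nat.factorial] using
        sliceCount_mul_le_of_card (m := 1) hs hu ht hts (by decide) (by decide)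
  · have := sliceCount_values_two (t := t) (by omega : #s' = 2) hu' hne'
    omega

/-- In dimensions 4 to 7 the least chain counts 2, 4, 12, 36 give the maxima. The largest counts in
the middle levels, `2! * (d - 2)!` = 4, 12, 48, 240, give at least 6, 10, 15, 21 items in the
separated case. Prisms cause no trouble because each even gap is twice a gap one dimension lower. -/
lemma sliceCount_values_four (hs : #s = 4) (hu : ∀ i ∈ s, 0 ≤ u i) (hne : ∃ i ∈ s, u i ≠ 0) :
    sliceCount s u t ≤ 12 ∧ sliceCount s u t ≠ 3 ∧ sliceCount s u t ≠ 5 := by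
  rcases pos_or_exists_sliceCount_eq hu hne t with hu | ⟨s', h', hu', hne', hc⟩
  · rcases sliceCount_le_one_or (t := t) hu with h | ⟨ht, hts⟩
    · omega
    · have hle := sliceCount_mul_le_of_card (m := 2) hs hu ht hts (by decide) (by decide)
      have hf : 4 ! = 24 := rfl
      rcases sliceCount_structure hs hu ht hts with ⟨a, c, n, ha, h1, h2, h3, h4, h5⟩ | h
      · interval_cases a <;> norm_num [Nat.choose] at h1 h2 h3 h4 h5 <;> omega
      · have := h 4 (by decide) (by decide)
        omega
  · have := sliceCount_values_three (t := t) (by omega : #s' = 3) hu' hne'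
    omega

lemma sliceCount_values_five (hs : #s = 5) (hu : ∀ i ∈ s, 0 ≤ u i) (hne : ∃ i ∈ s, u i ≠ 0) :
    sliceCount s u t ≤ 30 ∧ sliceCount s u t ≠ 3 ∧ sliceCount s u t ≠ 6 ∧
      sliceCount s u t ≠ 7 ∧ sliceCount s u t ≠ 9 := by
  rcases pos_or_exists_sliceCount_eq hu hne t with hu | ⟨s', h', hu', hne', hc⟩
  · rcases sliceCount_le_one_or (t := t) hu with h | ⟨ht, hts⟩
    · omega
    · have hle := sliceCount_mul_le_of_card (m := 4) hs hu ht hts (by decide) (by decide)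
      have hf : 5 ! = 120 := rfl
      rcases sliceCount_structure hs hu ht hts with ⟨a, c, n, ha, h1, h2, h3, h4, h5⟩ | h
      · interval_cases a <;> norm_num [Nat.choose] at h1 h2 h3 h4 h5 <;> omega
      · have := h 12 (by decide) (by decide)
        omega
  · have := sliceCount_values_four (t := t) (by omega : #s' = 4) hu' hne'
    omega

lemma sliceCount_values_six (hs : #s = 6) (hu : ∀ i ∈ s, 0 ≤ u i) (hne : ∃ i ∈ s, u i ≠ 0) :
    sliceCount s u t ≤ 60 ∧ sliceCount s u t ≠ 3 ∧ sliceCount s u t ≠ 5 ∧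
      sliceCount s u t ≠ 7 ∧ sliceCount s u t ≠ 9 ∧ sliceCount s u t ≠ 11 ∧
      sliceCount s u t ≠ 12 ∧ sliceCount s u t ≠ 59 := by
  rcases pos_or_exists_sliceCount_eq hu hne t with hu | ⟨s', h', hu', hne', hc⟩
  · rcases sliceCount_le_one_or (t := t) hu with h | ⟨ht, hts⟩
    · omega
    · have hle := sliceCount_mul_le_of_card (m := 12) hs hu ht hts (by decide) (by decide)
      have hf : 6 ! = 720 := rfl
      have h59 := sliceCount_ne_fiftynine hs hu ht hts
      rcases sliceCount_structure hs hu ht hts with ⟨a, c, n, ha, h1, h2, h3, h4, h5⟩ | h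
      · interval_cases a <;> norm_num [Nat.choose] at h1 h2 h3 h4 h5 <;> omega
      · have := h 48 (by decide) (by decide)
        omega
  · have := sliceCount_values_five (t := t) (by omega : #s' = 5) hu' hne'
    omega

lemma sliceCount_values_seven (hs : #s = 7) (hu : ∀ i ∈ s, 0 ≤ u i) (hne : ∃ i ∈ s, u i ≠ 0) :
    sliceCount s u t ≤ 140 ∧ sliceCount s u t ≠ 3 ∧ sliceCount s u t ≠ 5 ∧
      sliceCount s u t ≠ 6 ∧ sliceCount s u t ≠ 9 ∧ sliceCount s u t ≠ 10 ∧
      sliceCount s u t ≠ 11 ∧ sliceCount s u t ≠ 13 ∧ sliceCount s u t ≠ 14 ∧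
      sliceCount s u t ≠ 15 ∧ sliceCount s u t ≠ 18 := by
  rcases pos_or_exists_sliceCount_eq hu hne t with hu | ⟨s', h', hu', hne', hc⟩
  · rcases sliceCount_le_one_or (t := t) hu with h | ⟨ht, hts⟩
    · omega
    · have hle := sliceCount_mul_le_of_card (m := 36) hs hu ht hts (by decide) (by decide)
      have hf : 7 ! = 5040 := rfl
      rcases sliceCount_structure hs hu ht hts with ⟨a, c, n, ha, h1, h2, h3, h4, h5⟩ | h
      · interval_cases a <;> norm_num [Nat.choose] at h1 h2 h3 h4 h5 <;> omega
      · have := h 240 (by decide) (by decide)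
        omega
  · have := sliceCount_values_six (t := t) (by omega : #s' = 6) hu' hne'
    omega

end Values

/-! ### From extreme points of slices to counted vertices and edges -/

section Geometry

variable {ι : Type*} [Fintype ι] {u x : ι → ℝ} {t : ℝ}

/-- The slice of the cube `[0, 1]^ι` by the hyperplane `∑ i, u i * x i = t`. -/
def cubeSlice (u : ι → ℝ) (t : ℝ) : Set (ι → ℝ) :=
  {x | ∑ i, u i * x i = t} ∩ Set.Icc 0 1

/-- The vertices of a slice of the cube: at most one coordinate is fractional, and the weight of
that coordinate is not zero. -/
def sliceVertices (u : ι → ℝ) (t : ℝ) : Set (ι → ℝ) :=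
  {x ∈ cubeSlice u t | ∀ i, 0 < x i → x i < 1 → u i ≠ 0 ∧ ∀ j, 0 < x j → x j < 1 → j = i}

/-- A direction tangent to the hyperplane and supported on fractional coordinates can be followed
both ways: `x` is the midpoint of `x + ε • v` and `x - ε • v`, both in the slice for small `ε`. -/
lemma eq_zero_of_mem_extremePoints (hx : x ∈ (cubeSlice u t).extremePoints ℝ) {v : ι → ℝ}
    (hv : ∑ i, u i * v i = 0) (hs : ∀ i, v i ≠ 0 → 0 < x i ∧ x i < 1) : v = 0 := by
  obtain ⟨⟨hxt, hx0, hx1⟩, hext⟩ := hx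
  have hsum : ∀ ε : ℝ, ∑ i, u i * (x + ε • v) i = t := by
    intro ε
    simp only [Pi.add_apply, Pi.smul_apply, smul_eq_mul, mul_add, sum_add_distrib,
      mul_left_comm _ ε, ← mul_sum, hv, mul_zero, add_zero]
    exact hxt
  have hnear : ∀ i, ∀ᶠ ε : ℝ in nhds 0, x i + ε * v i ∈ Set.Icc (0 : ℝ) 1 := by
    intro i
    by_cases h : v i = 0
    · simp only [h, mul_zero, add_zero]
      exact Filter.Eventually.of_forall fun _ => ⟨hx0 i, hx1 i⟩
    · have hc : ContinuousAt (fun ε : ℝ => x i + ε * v i) 0 := by fun_prop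
      refine hc.eventually (Icc_mem_nhds ?_ ?_) <;> simpa using by first
        | exact (hs i h).1
        | exact (hs i h).2
  have hnear' := Filter.eventually_all.2 hnear
  have hneg : Filter.Tendsto (fun ε : ℝ => -ε) (nhds 0) (nhds 0) := by
    simpa using (continuous_neg (G := ℝ)).tendsto 0
  obtain ⟨ε, ⟨h1, h2⟩, hε⟩ := (((hnear'.and (hneg.eventually hnear')).filter_mono
    nhdsWithin_le_nhds).and (self_mem_nhdsWithin (s := Set.Ioi (0 : ℝ)))).exists
  have hmem : ∀ δ : ℝ, (∀ i, x i + δ * v i ∈ Set.Icc (0 : ℝ) 1) → x + δ • v ∈ cubeSlice u t :=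
    fun δ h => ⟨hsum δ, fun i => (h i).1, fun i => (h i).2⟩
  have h := hext (hmem ε h1) (hmem (-ε) h2)
    ⟨1 / 2, 1 / 2, by norm_num, by norm_num, by norm_num, by ext i; simp; ring⟩
  simpa [(show (0 : ℝ) < ε from hε).ne'] using h

lemma extremePoints_cubeSlice (u : ι → ℝ) (t : ℝ) :
    (cubeSlice u t).extremePoints ℝ = sliceVertices u t := by
  classical
  ext x
  constructor
  · intro hx
    refine ⟨hx.1, fun i hi0 hi1 => ?_⟩
    have hu : ∀ i, 0 < x i → x i < 1 → u i ≠ 0 := by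
      intro i hi0 hi1 h
      have := eq_zero_of_mem_extremePoints hx (v := Pi.single i 1) (by simp [Pi.single_apply, h])
        (fun j hj => by
          obtain rfl : j = i := by by_contra hne; simp [hne] at hj
          exact ⟨hi0, hi1⟩)
      simpa using congrFun this i
    refine ⟨hu i hi0 hi1, fun j hj0 hj1 => ?_⟩
    by_contra hne
    -- Two fractional coordinates can be traded against each other without leaving the hyperplane.
    have := eq_zero_of_mem_extremePoints hx (v := Pi.single i (u j) - Pi.single j (u i))
      (by simp [Pi.single_apply, mul_sub, mul_comm])
      (fun k hk => by
        by_cases h1 : k = i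
        · exact h1 ▸ ⟨hi0, hi1⟩
        by_cases h2 : k = j
        · exact h2 ▸ ⟨hj0, hj1⟩
        simp [h1, h2] at hk)
    have h := congrFun this i
    simp [Ne.symm hne] at h
    exact hu j hj0 hj1 h
  · rintro ⟨hx, hv⟩
    refine mem_extremePoints_iff_left.2 ⟨hx, ?_⟩
    rintro y ⟨hyt, hy0, hy1⟩ z ⟨hzt, hz0, hz1⟩ ⟨a, b, ha, hb, hab, rfl⟩
    simp only [Pi.add_apply, Pi.smul_apply, smul_eq_mul] at hv
    -- A coordinate equal to 0 or 1 is constant along any segment in the cube through the point; a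
    -- single fractional one is then fixed by the hyperplane equation, its weight being nonzero.
    have key : ∀ i, ¬ (0 < a * y i + b * z i ∧ a * y i + b * z i < 1) →
        y i = a * y i + b * z i := by
      intro i hi
      have h1 := hy0 i
      have h2 := hy1 i
      have h3 := hz0 i
      have h4 := hz1 i
      simp only [Pi.zero_apply, Pi.one_apply] at h1 h2 h3 h4
      have hb' : b = 1 - a := by linarith
      by_cases h0 : 0 < a * y i + b * z i
      · have h5 : 1 ≤ a * y i + b * z i := not_lt.1 fun h => hi ⟨h0, h⟩
        have h6 : y i = 1 := by nlinarith
        have h7 : z i = 1 := by nlinarith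
        rw [h6, h7]; linarith
      · have h6 : y i = 0 := by nlinarith [mul_nonneg ha.le h1, mul_nonneg hb.le h3]
        have h7 : z i = 0 := by nlinarith [mul_nonneg ha.le h1, mul_nonneg hb.le h3]
        rw [h6, h7]; ring
    by_cases hfrac : ∃ i, 0 < a * y i + b * z i ∧ a * y i + b * z i < 1
    · obtain ⟨i, hi0, hi1⟩ := hfrac
      obtain ⟨hui, huniq⟩ := hv i hi0 hi1
      have hother : ∀ j ≠ i, y j = a * y j + b * z j :=
        fun j hj => key j fun h => hj (huniq j h.1 h.2)
      ext j
      by_cases hj : j = i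
      · subst hj
        have h1 : ∑ k, u k * (y k - (a • y + b • z) k) = 0 := by
          simp only [mul_sub, sum_sub_distrib]
          exact sub_eq_zero.2 (Eq.trans hyt hx.1.symm)
        rw [sum_eq_single j (fun k _ hk => by
          rw [mul_eq_zero, sub_eq_zero]; exact .inr (hother k hk)) (by simp)] at h1
        exact sub_eq_zero.1 ((mul_eq_zero.1 h1).resolve_left hui)
      · exact hother j hj
    · ext j
      exact key j fun h => hfrac ⟨j, h⟩

/-- Reflections in the directions of the negative weights make all weights nonnegative. -/
lemma encard_sliceVertices_abs (u : ι → ℝ) (t : ℝ) :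
    (sliceVertices u t).encard =
      (sliceVertices (fun i => |u i|) (t - ∑ i, min (u i) 0)).encard := by
  let σ : (ι → ℝ) → ι → ℝ := fun x i => if u i < 0 then 1 - x i else x i
  have hσ : Function.Involutive σ := by
    intro x; ext i; simp only [σ]; split_ifs <;> ring
  have hpre : sliceVertices u t = σ ⁻¹' sliceVertices (fun i => |u i|) (t - ∑ i, min (u i) 0) := by
    ext x
    have h1 : ∀ i, |u i| * σ x i = u i * x i - min (u i) 0 := by
      intro i
      simp only [σ]
      split_ifs with h
      · rw [abs_of_neg h, min_eq_left h.le]; ring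
      · rw [abs_of_nonneg (not_lt.1 h), min_eq_right (not_lt.1 h)]; ring
    have h2 : ∀ i, (0 ≤ x i ∧ x i ≤ 1) ↔ (0 ≤ σ x i ∧ σ x i ≤ 1) := by
      intro i; simp only [σ]; split_ifs <;> constructor <;> intro h <;> constructor <;> linarith
    have h3 : ∀ i, (0 < x i ∧ x i < 1) ↔ (0 < σ x i ∧ σ x i < 1) := by
      intro i; simp only [σ]; split_ifs <;> constructor <;> intro h <;> constructor <;> linarith
    simp only [sliceVertices, cubeSlice, Set.mem_preimage, Set.mem_ofPred_eq, Set.mem_inter_iff,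
      Set.mem_Icc, Pi.le_def, Pi.zero_apply, Pi.one_apply, ← forall_and, ← and_imp, h1, ← h2,
      ← h3, sum_sub_distrib, sub_left_inj, abs_ne_zero]
  rw [hpre, ← hσ.bijective.injective.encard_image, Set.image_preimage_eq _ hσ.bijective.surjective]

/-- The vertices of a slice are the vertices of the cube on the hyperplane and the points where
the hyperplane crosses an edge. -/
lemma encard_sliceVertices [DecidableEq ι] (hu : ∀ i, 0 ≤ u i) (t : ℝ) :
    (sliceVertices u t).encard = sliceCount univ u t := by
  let ind : Finset ι → ι → ℝ := fun S i => if i ∈ S then 1 else 0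
  -- The point where the edge meets the hyperplane; for `p ∈ E` the divisor is positive. Its
  -- coordinates equal to 1 recover `p.1` and its fractional coordinate recovers `p.2`, whence
  -- injectivity.
  let cross : Finset ι × ι → ι → ℝ := fun p =>
    ind p.1 + Pi.single p.2 ((t - ∑ i ∈ p.1, u i) / u p.2)
  set Z : Finset (Finset ι) := {S ∈ univ.powerset | ∑ i ∈ S, u i = t} with hZ
  set E : Finset (Finset ι × ι) := {p ∈ univ.powerset ×ˢ univ |
    ∑ i ∈ p.1, u i < t ∧ t < ∑ i ∈ insert p.2 p.1, u i} with hE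
  have hsum : ∀ S, ∑ i, u i * ind S i = ∑ i ∈ S, u i := by
    intro S; simp [ind]
  have hcross : ∀ p ∈ E, p.2 ∉ p.1 ∧ 0 < u p.2 ∧ 0 < cross p p.2 ∧ cross p p.2 < 1 := by
    rintro ⟨S, i⟩ hp
    simp only [hE, mem_filter] at hp
    obtain ⟨-, h1, h2⟩ := hp
    have hi : i ∉ S := fun h => by rw [insert_eq_of_mem h] at h2; linarith
    rw [sum_insert hi] at h2
    have hui : 0 < u i := by linarith
    refine ⟨hi, hui, ?_, ?_⟩
    · simp only [cross, ind, Pi.add_apply, hi, if_false, Pi.single_eq_same, zero_add]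
      exact div_pos (by linarith) hui
    · simp only [cross, ind, Pi.add_apply, hi, if_false, Pi.single_eq_same, zero_add]
      rw [div_lt_one hui]
      linarith
  have hcross' : ∀ (p : Finset ι × ι), ∀ j ≠ p.2, cross p j = ind p.1 j := by
    intro p j hj; simp [cross, hj]
  have hind : ∀ S i, ind S i = 0 ∨ ind S i = 1 := by
    intro S i; simp only [ind]; split_ifs <;> simp
  have hind1 : ∀ S i, ind S i = 1 ↔ i ∈ S := by
    intro S i; simp only [ind]; split_ifs with h <;> simp [h]
  have hfrac : ∀ p ∈ E, ∀ j, 0 < cross p j → cross p j < 1 → j = p.2 := by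
    intro p _ j h0 h1
    by_contra hne
    rw [hcross' p j hne] at h0 h1
    rcases hind p.1 j with h | h <;> rw [h] at h0 h1 <;> linarith
  have hone : ∀ p ∈ E, ∀ j, cross p j = 1 ↔ j ∈ p.1 := by
    intro p hp j
    by_cases hj : j = p.2
    · obtain ⟨h1, -, -, h2⟩ := hcross p hp
      rw [hj]
      exact ⟨fun h => by linarith, fun h => (h1 h).elim⟩
    · rw [hcross' p j hj, hind1]
  have hX : sliceVertices u t = ind '' Z ∪ cross '' E := by
    ext x
    constructor
    · rintro ⟨⟨hxt, hx0, hx1⟩, hv⟩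
      simp only [Set.mem_ofPred_eq] at hxt
      set S : Finset ι := {i | x i = 1} with hS
      have hint : ∀ i, ¬ (0 < x i ∧ x i < 1) → x i = ind S i := by
        intro i hi
        by_cases h : x i = 1
        · rw [h, eq_comm, hind1]; simp [hS, h]
        · have h1 : x i < 1 := lt_of_le_of_ne (hx1 i) h
          have h2 : x i = 0 := le_antisymm (not_lt.1 fun h => hi ⟨h, h1⟩) (hx0 i)
          simp [ind, hS, h2]
      by_cases hf : ∃ i, 0 < x i ∧ x i < 1
      · obtain ⟨i, hi0, hi1⟩ := hf
        obtain ⟨hui, huniq⟩ := hv i hi0 hi1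
        have hui' : 0 < u i := (hu i).lt_of_ne hui.symm
        have hiS : i ∉ S := by simp [hS, hi1.ne]
        have hxe : x = ind S + Pi.single i (x i) := by
          ext j
          by_cases hj : j = i
          · subst hj; simp [ind, hiS]
          · simpa [hj] using hint j fun h => hj (huniq j h.1 h.2)
        have hxs : ∑ k ∈ S, u k + u i * x i = t := by
          rw [← hxt, ← hsum]
          conv_rhs => rw [hxe]
          simp [mul_add, sum_add_distrib, Pi.single_apply]
        refine .inr ⟨(S, i), ?_, ?_⟩
        · simp only [hE, coe_filter, mem_product, mem_powerset, subset_univ, mem_univ, and_self,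
            true_and, Set.mem_ofPred_eq]
          rw [sum_insert hiS]
          constructor <;> nlinarith
        · simp only [cross]
          conv_rhs => rw [hxe]
          congr 2
          rw [div_eq_iff hui]
          linarith
      · refine .inl ⟨S, ?_, ?_⟩
        · have hxe : x = ind S := funext fun i => hint i fun h => hf ⟨i, h⟩
          simp only [hZ, coe_filter, mem_powerset, subset_univ, true_and, Set.mem_ofPred_eq]
          rw [← hsum, ← hxe, hxt]
        · exact funext fun i => (hint i fun h => hf ⟨i, h⟩).symm
    · rintro (⟨S, hS, rfl⟩ | ⟨p, hp, rfl⟩)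
      · refine ⟨⟨?_, fun i => ?_, fun i => ?_⟩, fun i h0 h1 => ?_⟩
        · exact (hsum S).trans (mem_filter.1 hS).2
        · rcases hind S i with h | h <;> simp [h]
        · rcases hind S i with h | h <;> simp [h]
        · rcases hind S i with h | h <;> rw [h] at h0 h1 <;> linarith
      · obtain ⟨hpS, hup, h0, h1⟩ := hcross p hp
        have hb : ∀ i, 0 ≤ cross p i ∧ cross p i ≤ 1 := by
          intro i
          by_cases hi : i = p.2
          · rw [hi]; exact ⟨h0.le, h1.le⟩
          · rw [hcross' p i hi]
            rcases hind p.1 i with h | h <;> simp [h]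
        refine ⟨⟨?_, fun i => (hb i).1, fun i => (hb i).2⟩, fun i hi0 hi1 => ?_⟩
        · simp only [cross, Set.mem_ofPred_eq, Pi.add_apply, mul_add, sum_add_distrib, hsum,
            Pi.single_apply, mul_ite, mul_zero, sum_ite_eq', mem_univ, if_true,
            mul_div_cancel₀ _ hup.ne']
          ring
        · obtain rfl := hfrac p hp i hi0 hi1
          exact ⟨hup.ne', hfrac p hp⟩
  have hdisj : Disjoint (ind '' (Z : Set (Finset ι))) (cross '' (E : Set (Finset ι × ι))) := by
    rw [Set.disjoint_left]
    rintro _ ⟨S, -, rfl⟩ ⟨p, hp, h⟩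
    obtain ⟨-, -, h0, h1⟩ := hcross p hp
    rw [h] at h0 h1
    rcases hind S p.2 with h | h <;> rw [h] at h0 h1 <;> linarith
  have hinj : Function.Injective ind := by
    intro S T h
    ext i
    rw [← hind1, ← hind1 T, h]
  have hinj' : Set.InjOn cross E := by
    intro p hp q hq h
    have h1 : p.1 = q.1 := by
      ext i
      rw [← hone p hp, ← hone q hq, h]
    have h2 : p.2 = q.2 := by
      obtain ⟨-, -, h0, h1⟩ := hcross p hp
      rw [h] at h0 h1
      exact hfrac q hq _ h0 h1
    exact Prod.ext h1 h2
  rw [hX, Set.encard_union_eq hdisj, hinj.encard_image, hinj'.encard_image,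
    Set.encard_coe_eq_coe_finsetCard, Set.encard_coe_eq_coe_finsetCard, sliceCount, Nat.cast_add]

lemma hypercube_eq (d : ℕ) : hypercube d = {x | ∀ i, 0 ≤ x i ∧ x i ≤ 1} := by
  have h : {x : EuclideanSpace ℝ (Fin d) | ∀ i, x i = 0 ∨ x i = 1} =
      (WithLp.linearEquiv 2 ℝ (Fin d → ℝ)).symm.toLinearMap ''
        (Set.univ.pi fun _ => ({0, 1} : Set ℝ)) := by
    ext x
    constructor
    · exact fun hx => ⟨x.ofLp, by simpa using hx, rfl⟩
    · rintro ⟨y, hy, rfl⟩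
      simpa using hy
  rw [hypercube, h, ← LinearMap.image_convexHull, convexHull_pi, convexHull_pair,
    segment_eq_Icc zero_le_one]
  ext x
  constructor
  · rintro ⟨y, hy, rfl⟩
    exact fun i => hy i (Set.mem_univ i)
  · exact fun hx => ⟨x.ofLp, fun i _ => hx i, rfl⟩

lemma hyperplane_inter_hypercube {d : ℕ} (u : EuclideanSpace ℝ (Fin d)) (t : ℝ) :
    {x | inner ℝ u x = t} ∩ hypercube d =
      (WithLp.linearEquiv 2 ℝ (Fin d → ℝ)).symm '' cubeSlice u.ofLp t := by
  rw [hypercube_eq]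
  ext x
  have hin : inner ℝ u x = ∑ i, u i * x i := by
    simp [PiLp.inner_apply, mul_comm]
  constructor
  · rintro ⟨h1, h2⟩
    exact ⟨x.ofLp, ⟨hin.symm.trans h1, fun i => (h2 i).1, fun i => (h2 i).2⟩, rfl⟩
  · rintro ⟨y, ⟨h1, h2, h3⟩, rfl⟩
    exact ⟨hin.trans h1, fun i => ⟨h2 i, h3 i⟩⟩

lemma cv_hypercube {d : ℕ} (u : EuclideanSpace ℝ (Fin d)) (t : ℝ) :
    cv (hypercube d) {x | inner ℝ u x = t} =
      sliceCount univ (fun i => |u i|) (t - ∑ i, min (u i) 0) := by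
  rw [cv, hyperplane_inter_hypercube, ← image_extremePoints, extremePoints_cubeSlice,
    (WithLp.linearEquiv 2 ℝ (Fin d → ℝ)).symm.injective.encard_image, encard_sliceVertices_abs,
    encard_sliceVertices fun i => abs_nonneg _]

/-- A nonempty slice is compact and therefore has an extreme point. -/
lemma nonempty_iff_sliceCount_ne_zero {d : ℕ} (u : EuclideanSpace ℝ (Fin d)) (t : ℝ) :
    ({x | inner ℝ u x = t} ∩ hypercube d).Nonempty ↔
      sliceCount univ (fun i => |u i|) (t - ∑ i, min (u i) 0) ≠ 0 := by
  rw [← Nat.cast_ne_zero (R := ℕ∞), ← encard_sliceVertices fun i => abs_nonneg _,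
    ← encard_sliceVertices_abs, Set.encard_ne_zero, ← extremePoints_cubeSlice,
    hyperplane_inter_hypercube, Set.image_nonempty]
  refine ⟨fun h => IsCompact.extremePoints_nonempty ?_ h, fun h => h.mono extremePoints_subset⟩
  have hcl : IsClosed {x : Fin d → ℝ | ∑ i, u i * x i = t} :=
    isClosed_eq (by fun_prop) continuous_const
  rw [cubeSlice, Set.inter_comm]
  exact isCompact_Icc.inter_right hcl

/-- The vertex slice sequence of the cube in terms of nonnegative weights. -/
lemma mem_VSS_hypercube_iff {d m : ℕ} :
    m ∈ VSS (hypercube d) ↔ m ≠ 0 ∧ ∃ w : Fin d → ℝ, (∀ i, 0 ≤ w i) ∧ (∃ i, w i ≠ 0) ∧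
      ∃ t, sliceCount univ w t = m := by
  constructor
  · rintro ⟨_, ⟨u, t, hu, rfl⟩, hne, hcv⟩
    rw [cv_hypercube, Nat.cast_inj] at hcv
    rw [nonempty_iff_sliceCount_ne_zero, hcv] at hne
    refine ⟨hne, _, fun i => abs_nonneg _, ?_, _, hcv⟩
    by_contra! h
    exact hu (by ext i; simpa using h i)
  · rintro ⟨hm, w, hw, ⟨i, hi⟩, t, hc⟩
    have hs : sliceCount univ (fun i => |WithLp.toLp 2 w i|) (t - ∑ i, min (WithLp.toLp 2 w i) 0) =
        m := by
      simp only [abs_of_nonneg (hw _), min_eq_right (hw _), sum_const_zero, sub_zero]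
      exact hc
    refine ⟨_, ⟨WithLp.toLp 2 w, t, ?_, rfl⟩, ?_, ?_⟩
    · intro h
      exact hi (by simpa using congrArg (fun v : EuclideanSpace ℝ (Fin d) => v i) h)
    · rw [nonempty_iff_sliceCount_ne_zero, hs]
      exact hm
    · rw [cv_hypercube, hs]

end Geometry

/-! ### Computable counts and slices attaining the remaining values -/

section Witnesses

/-- The number of subsets of the list of weights whose sum, increased by `c`, is below `t`, but
exceeds `t` after adding `a`. -/
def crossList (a t : ℕ) : List ℕ → ℕ → ℕ
  | [], c => if c < t ∧ t < c + a then 1 else 0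
  | b :: l, c => crossList a t l c + crossList a t l (c + b)

/-- `sliceCount` for a list of natural weights and the threshold `t - c`. -/
def sliceCountList (t : ℕ) : List ℕ → ℕ → ℕ
  | [], c => if c = t then 1 else 0
  | a :: l, c => sliceCountList t l c + sliceCountList t l (c + a) + crossList a t l c

lemma crossList_eq {ι : Type*} [DecidableEq ι] (w : ι → ℕ) (a t : ℕ) (l : List ι) (hl : l.Nodup)
    (c : ℕ) : crossList a t (l.map w) c =
      #{S ∈ l.toFinset.powerset | ∑ i ∈ S, (w i : ℝ) < t - c ∧ t - c < ∑ i ∈ S, (w i : ℝ) + a} := by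
  induction l generalizing c with
  | nil =>
    have h1 : ((0 : ℝ) < t - c ∧ (t : ℝ) - c < a) ↔ (c < t ∧ t < c + a) := by
      rw [← Nat.cast_lt (α := ℝ), ← Nat.cast_lt (α := ℝ) (n := c + a), Nat.cast_add, sub_pos,
        sub_lt_iff_lt_add']
    simp only [List.map_nil, crossList, List.toFinset_nil, powerset_empty, filter_singleton,
      sum_empty, zero_add, h1]
    split_ifs <;> simp
  | cons b l ih =>
    rw [List.nodup_cons] at hl
    have hb : b ∉ l.toFinset := by simpa using hl.1
    rw [List.map_cons, crossList, ih hl.2, ih hl.2, List.toFinset_cons, card_filter, card_filter,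
      card_filter, sum_powerset_insert hb]
    congr 1
    refine sum_congr rfl fun S hS => ?_
    rw [sum_insert fun h => hb (mem_powerset.1 hS h)]
    refine if_congr ?_ rfl rfl
    push_cast
    constructor <;> rintro ⟨h1, h2⟩ <;> constructor <;> linarith

lemma sliceCountList_eq {ι : Type*} [DecidableEq ι] (w : ι → ℕ) (t : ℕ) (l : List ι)
    (hl : l.Nodup) (c : ℕ) : sliceCountList t (l.map w) c =
      sliceCount l.toFinset (fun i => (w i : ℝ)) (t - c) := by
  induction l generalizing c with
  | nil =>
    have h1 : (0 : ℝ) = t - c ↔ c = t := by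
      rw [eq_comm, sub_eq_zero, Nat.cast_inj, eq_comm]
    simp only [List.map_nil, sliceCountList, sliceCount, List.toFinset_nil, powerset_empty,
      filter_singleton, sum_empty, h1, product_empty, filter_empty, card_empty, add_zero]
    split_ifs <;> simp
  | cons a l ih =>
    rw [List.nodup_cons] at hl
    rw [List.map_cons, sliceCountList, ih hl.2, ih hl.2, List.toFinset_cons,
      sliceCount_insert (by simpa using hl.1), crossList_eq w _ _ _ hl.2]
    push_cast
    rw [sub_sub]

lemma mem_VSS_of_list {d m t : ℕ} {w : List ℕ} (hd : w.length = d) (hw : ∃ a ∈ w, a ≠ 0)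
    (hm : m ≠ 0) (h : sliceCountList t w 0 = m) : m ∈ VSS (hypercube d) := by
  subst hd
  refine mem_VSS_hypercube_iff.2 ⟨hm, fun i => (w[i] : ℝ), fun i => Nat.cast_nonneg _, ?_, t, ?_⟩
  · obtain ⟨a, ha, ha0⟩ := hw
    obtain ⟨i, hi, rfl⟩ := List.mem_iff_getElem.1 ha
    exact ⟨⟨i, hi⟩, by simpa using ha0⟩
  · have h1 := sliceCountList_eq (fun i : Fin w.length => w[i]) t (List.finRange _)
      (List.nodup_finRange _) 0
    rw [List.toFinset_finRange, Nat.cast_zero, sub_zero] at h1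
    rw [← h1, ← h]
    congr 1
    rw [← List.ofFn_eq_map]
    exact List.ofFn_getElem

/-- The prisms over given slices, cut out by the same hyperplanes with an additional weight `0`. -/
def prisms (L : List (ℕ × List ℕ × ℕ)) : List (ℕ × List ℕ × ℕ) :=
  L.map fun p => (2 * p.1, 0 :: p.2.1, p.2.2)

/-- Slices of the `2`-cube: number of vertices, weights, threshold. -/
def slicesTwo : List (ℕ × List ℕ × ℕ) := prisms [(1, [1], 0)] ++
  [(1, [1, 1], 0)]

/-- Slices of the `3`-cube: number of vertices, weights, threshold. -/
def slicesThree : List (ℕ × List ℕ × ℕ) := prisms slicesTwo ++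
  [(1, [1, 1, 1], 0), (3, [1, 1, 1], 1), (5, [2, 2, 3], 3), (6, [2, 2, 2], 3)]

/-- Slices of the `4`-cube: number of vertices, weights, threshold. -/
def slicesFour : List (ℕ × List ℕ × ℕ) := prisms slicesThree ++
  [(1, [1, 1, 1, 1], 0), (7, [1, 1, 1, 2], 2), (9, [1, 2, 2, 2], 3), (11, [2, 2, 3, 3], 4)]

/-- Slices of the `5`-cube: number of vertices, weights, threshold. -/
def slicesFive : List (ℕ × List ℕ × ℕ) := prisms slicesFour ++
  [(1, [1, 1, 1, 1, 1], 0), (5, [1, 1, 1, 1, 1], 1), (10, [1, 1, 1, 1, 1], 2),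
   (11, [1, 1, 1, 1, 2], 2), (13, [1, 1, 2, 3, 3], 3), (15, [1, 1, 1, 2, 2], 3),
   (17, [1, 1, 2, 3, 3], 4), (19, [1, 2, 2, 2, 3], 4), (21, [1, 1, 3, 3, 3], 5),
   (23, [1, 3, 3, 4, 4], 6), (25, [2, 2, 4, 5, 5], 8), (26, [2, 2, 2, 3, 3], 6),
   (27, [2, 2, 4, 4, 4], 7), (28, [2, 2, 2, 4, 4], 7), (29, [4, 4, 4, 6, 6], 11),
   (30, [2, 2, 2, 2, 2], 5)]

/-- Slices of the `6`-cube: number of vertices, weights, threshold. -/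
def slicesSix : List (ℕ × List ℕ × ℕ) := prisms slicesFive ++
  [(1, [1, 1, 1, 1, 1, 1], 0), (6, [1, 1, 1, 1, 1, 1], 1), (13, [1, 1, 2, 2, 2, 2], 2),
   (14, [2, 2, 3, 3, 3, 3], 3), (15, [1, 1, 1, 1, 1, 1], 2), (17, [2, 2, 3, 4, 4, 4], 4),
   (18, [1, 1, 2, 3, 3, 3], 3), (19, [1, 2, 2, 2, 3, 3], 3), (21, [1, 2, 2, 4, 4, 4], 4),
   (23, [1, 1, 1, 2, 3, 3], 3), (25, [1, 1, 1, 1, 1, 2], 3), (27, [1, 1, 1, 3, 3, 3], 4),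
   (29, [2, 2, 3, 3, 3, 3], 4), (31, [1, 1, 1, 1, 2, 3], 4), (33, [1, 1, 1, 2, 2, 2], 4),
   (35, [1, 1, 1, 2, 2, 4], 5), (37, [1, 1, 1, 2, 3, 3], 5), (39, [1, 1, 2, 3, 3, 3], 5),
   (41, [1, 1, 1, 3, 3, 4], 6), (43, [1, 2, 2, 2, 3, 3], 6), (45, [2, 2, 2, 2, 2, 3], 5),
   (47, [1, 2, 3, 3, 4, 4], 8), (49, [2, 2, 2, 2, 3, 3], 6), (51, [2, 3, 3, 3, 4, 4], 8),
   (53, [2, 2, 4, 4, 5, 5], 10), (55, [2, 2, 2, 2, 5, 5], 8), (57, [3, 3, 3, 3, 4, 4], 8)]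

/-- Slices of the `7`-cube: number of vertices, weights, threshold. -/
def slicesSeven : List (ℕ × List ℕ × ℕ) := prisms slicesSix ++
  [(1, [1, 1, 1, 1, 1, 1, 1], 0), (7, [1, 1, 1, 1, 1, 1, 1], 1), (17, [2, 2, 3, 3, 3, 3, 3], 3),
   (19, [1, 1, 1, 2, 2, 2, 2], 2), (21, [1, 1, 1, 1, 1, 1, 1], 2), (22, [1, 1, 1, 1, 1, 1, 2], 2),
   (23, [1, 1, 2, 3, 3, 3, 3], 3), (24, [1, 2, 2, 2, 3, 3, 3], 3), (25, [2, 2, 4, 5, 5, 5, 5], 5),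
   (27, [2, 2, 2, 2, 2, 2, 3], 4), (29, [1, 1, 1, 3, 3, 3, 3], 3), (31, [1, 1, 1, 2, 3, 3, 3], 3),
   (33, [1, 1, 1, 2, 2, 3, 3], 3), (35, [1, 1, 1, 1, 1, 1, 1], 3), (37, [1, 1, 1, 2, 2, 2, 2], 3),
   (39, [1, 1, 1, 1, 2, 2, 3], 3), (41, [1, 1, 1, 1, 1, 1, 2], 3), (43, [1, 2, 2, 3, 3, 3, 3], 4),
   (45, [1, 2, 2, 2, 2, 2, 2], 4), (47, [1, 1, 1, 1, 3, 4, 4], 4), (49, [1, 1, 1, 1, 3, 3, 3], 4),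
   (51, [1, 1, 1, 2, 2, 3, 3], 4), (53, [1, 1, 1, 1, 2, 3, 3], 4), (55, [1, 1, 2, 2, 2, 2, 2], 4),
   (57, [1, 1, 1, 1, 1, 2, 3], 4), (59, [1, 1, 1, 1, 3, 3, 4], 5), (61, [1, 1, 1, 1, 2, 4, 4], 5),
   (63, [1, 1, 1, 1, 1, 3, 3], 5), (65, [1, 1, 2, 2, 2, 3, 3], 5), (67, [1, 1, 1, 1, 2, 3, 3], 5),
   (69, [1, 1, 1, 2, 2, 3, 3], 5), (71, [1, 1, 1, 1, 2, 4, 4], 6), (73, [1, 1, 2, 2, 3, 3, 3], 6),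
   (75, [1, 2, 2, 2, 2, 2, 2], 5), (77, [1, 1, 2, 2, 2, 3, 3], 6), (79, [2, 2, 2, 3, 3, 3, 3], 6),
   (81, [2, 2, 2, 2, 2, 2, 3], 5), (83, [1, 2, 2, 2, 2, 3, 3], 6), (85, [1, 2, 2, 2, 2, 2, 3], 6),
   (87, [1, 1, 2, 2, 3, 3, 3], 7), (89, [2, 3, 3, 3, 3, 4, 4], 8), (91, [1, 2, 2, 2, 3, 3, 3], 7),
   (93, [1, 1, 2, 3, 4, 4, 4], 9), (95, [2, 2, 2, 2, 2, 2, 3], 7), (97, [1, 2, 3, 3, 3, 4, 4], 9),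
   (99, [2, 2, 2, 3, 4, 4, 4], 10), (101, [1, 1, 3, 3, 3, 4, 4], 9),
   (103, [2, 2, 3, 3, 4, 4, 4], 10), (105, [2, 2, 2, 2, 2, 2, 2], 5),
   (107, [1, 3, 3, 3, 3, 5, 5], 10), (109, [1, 3, 3, 3, 3, 4, 4], 9),
   (111, [1, 3, 4, 4, 4, 5, 5], 11), (113, [2, 2, 4, 4, 4, 5, 5], 12),
   (115, [2, 3, 3, 3, 3, 3, 5], 10), (117, [1, 4, 4, 4, 4, 5, 5], 11),
   (118, [2, 2, 2, 4, 4, 4, 4], 9), (119, [2, 2, 2, 2, 4, 6, 6], 11),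
   (121, [3, 3, 5, 5, 6, 6, 6], 16), (122, [2, 2, 2, 2, 2, 5, 5], 10),
   (123, [2, 2, 2, 4, 6, 6, 6], 13), (124, [3, 3, 3, 3, 5, 5, 5], 12),
   (125, [2, 2, 2, 2, 2, 2, 4], 7), (126, [2, 2, 2, 2, 4, 4, 4], 9),
   (127, [4, 4, 4, 4, 6, 6, 6], 15), (128, [3, 3, 3, 4, 4, 4, 4], 12),
   (129, [2, 4, 4, 4, 6, 6, 6], 15), (130, [2, 2, 2, 2, 2, 4, 4], 9),
   (131, [4, 4, 4, 5, 5, 5, 6], 16), (132, [2, 2, 2, 4, 4, 4, 4], 11),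
   (133, [4, 5, 5, 5, 5, 7, 7], 18), (134, [3, 3, 3, 3, 4, 4, 4], 12),
   (135, [4, 4, 4, 4, 4, 6, 6], 15), (136, [4, 4, 4, 6, 6, 6, 6], 17),
   (137, [4, 4, 4, 4, 5, 5, 5], 15), (138, [4, 4, 4, 4, 6, 6, 6], 17),
   (139, [6, 6, 6, 6, 8, 8, 8], 23), (140, [2, 2, 2, 2, 2, 2, 2], 7)]

lemma mem_VSS_of_slices {d : ℕ} (L : List (ℕ × List ℕ × ℕ))
    (hL : ∀ p ∈ L, p.2.1.length = d ∧ (∃ a ∈ p.2.1, a ≠ 0) ∧ p.1 ≠ 0 ∧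
      sliceCountList p.2.2 p.2.1 0 = p.1) {m : ℕ} (hm : m ∈ L.map Prod.fst) :
    m ∈ VSS (hypercube d) := by
  obtain ⟨p, hp, rfl⟩ := List.mem_map.1 hm
  obtain ⟨h1, h2, h3, h4⟩ := hL p hp
  exact mem_VSS_of_list h1 h2 h3 h4

/-- To determine the vertex slice sequence, bound `sliceCount` and give the slices. -/
lemma VSS_hypercube_eq {d n : ℕ} {F : List ℕ} (L : List (ℕ × List ℕ × ℕ))
    (hF : ∀ (u : Fin d → ℝ) (t : ℝ), (∀ i ∈ univ, 0 ≤ u i) → (∃ i ∈ univ, u i ≠ 0) →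
      sliceCount univ u t ≤ n ∧ sliceCount univ u t ∉ F)
    (hL : ∀ p ∈ L, p.2.1.length = d ∧ (∃ a ∈ p.2.1, a ≠ 0) ∧ p.1 ≠ 0 ∧
      sliceCountList p.2.2 p.2.1 0 = p.1)
    (hn : ∀ m < n + 1, m = 0 ∨ m ∈ F ∨ m ∈ L.map Prod.fst) :
    VSS (hypercube d) = Set.Icc 1 n \ {m | m ∈ F} := by
  ext m
  constructor
  · intro hm
    obtain ⟨h0, w, hw, ⟨i, hi⟩, t, rfl⟩ := mem_VSS_hypercube_iff.1 hm
    obtain ⟨h1, h2⟩ := hF w t (fun i _ => hw i) ⟨i, mem_univ i, hi⟩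
    exact ⟨⟨Nat.one_le_iff_ne_zero.2 h0, h1⟩, h2⟩
  · rintro ⟨⟨h1, h2⟩, h3⟩
    rcases hn m (Nat.lt_succ_of_le h2) with h | h | h
    · omega
    · exact (h3 h).elim
    · exact mem_VSS_of_slices L hL h

end Witnesses

theorem corollary1 :
    VSS (hypercube 2) = Set.Icc 1 2 ∧
    VSS (hypercube 3) = Set.Icc 1 6 ∧
    VSS (hypercube 4) = Set.Icc 1 12 \ {3, 5} ∧
    VSS (hypercube 5) = Set.Icc 1 30 \ {3, 6, 7, 9} ∧
    VSS (hypercube 6) = Set.Icc 1 60 \ {3, 5, 7, 9, 11, 12, 59} ∧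
    VSS (hypercube 7) = Set.Icc 1 140 \ {3, 5, 6, 9, 10, 11, 13, 14, 15, 18} := by
  refine ⟨?_, ?_, ?_, ?_, ?_, ?_⟩
  · have h := VSS_hypercube_eq (d := 2) (n := 2) (F := []) slicesTwo
      (fun u t h1 h2 => by
        have := sliceCount_values_two (t := t) (card_fin 2) h1 h2
        simpa using this)
      (by decide +kernel) (by decide +kernel)
    rw [h]
    ext m
    simp
  · have h := VSS_hypercube_eq (d := 3) (n := 6) (F := []) slicesThree
      (fun u t h1 h2 => by
        have := sliceCount_values_three (t := t) (card_fin 3) h1 h2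
        simpa using this)
      (by decide +kernel) (by decide +kernel)
    rw [h]
    ext m
    simp
  · have h := VSS_hypercube_eq (d := 4) (n := 12) (F := [3, 5]) slicesFour
      (fun u t h1 h2 => by
        have := sliceCount_values_four (t := t) (card_fin 4) h1 h2
        simpa using this)
      (by decide +kernel) (by decide +kernel)
    rw [h]
    ext m
    simp
  · have h := VSS_hypercube_eq (d := 5) (n := 30) (F := [3, 6, 7, 9]) slicesFive
      (fun u t h1 h2 => by
        have := sliceCount_values_five (t := t) (card_fin 5) h1 h2
        simpa using this)
      (by decide +kernel) (by decide +kernel)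
    rw [h]
    ext m
    simp
  · have h := VSS_hypercube_eq (d := 6) (n := 60) (F := [3, 5, 7, 9, 11, 12, 59]) slicesSix
      (fun u t h1 h2 => by
        have := sliceCount_values_six (t := t) (card_fin 6) h1 h2
        simpa using this)
      (by decide +kernel) (by decide +kernel)
    rw [h]
    ext m
    simp
  · have h := VSS_hypercube_eq (d := 7) (n := 140) (F := [3, 5, 6, 9, 10, 11, 13, 14, 15, 18]) slicesSeven
      (fun u t h1 h2 => by
        have := sliceCount_values_seven (t := t) (card_fin 7) h1 h2
        simpa using this)
      (by decide +kernel) (by decide +kernel)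
    rw [h]
    ext m
    simp
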